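/- Let $F$ be a field of characteristic zero. A Leibniz algebra over $F$ is a finite-dimensional $F$-vector space $\mathcal{A}$ with a bilinear multiplication satisfying $a(bc)=(ab)c+b(ac)$ for all $a,b,c\in\mathcal{A}$ (a left Leibniz algebra). A subalgebra $C$ of $\mathcal{A}$ is subinvariant in $\mathcal{A}$ if there is a finite chain of subalgebras $C=C_t\subseteq C_{t-1}\subseteq\cdots\subseteq C_0=\mathcal{A}$ such that $C_i$ is a two-sided ideal of $C_{i-1}$ for all $1\le i\le t$. For every Leibniz algebra $\mathcal{A}$ over $F$ and every subalgebra $B$ of $\mathcal{A}$, let $\underline{B}$ be the subalgebra generated by all subinvariant subalgebras of $\mathcal{A}$ contained in $B$. Then $\underline{B}$ is an ideal of $B$. Moreover, $\underline{B}$ is itself a subinvariant subalgebra of $\mathcal{A}$ contained in $B$; it contains every subinvariant subalgebra of $\mathcal{A}$ contained in $B$, and it is the unique maximal one. However, $\underline{B}$ need not be an ideal of $\mathcal{A}$: over every field $F$ of characteristic zero there are a Leibniz algebra $\mathcal{A}$ and a subalgebra $B$ of $\mathcal{A}$ such that $\underline{B}$ is not an ideal of $\mathcal{A}$. -/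

import Mathlib

universe u v

/-- The left Leibniz identity: every left multiplication operator `y ↦ a * y` is a derivation.
Together with `[Module F A] [IsScalarTower F A A] [SMulCommClass F A A]`, which say that the
multiplication is `F`-bilinear, this makes `A` a left Leibniz algebra over `F`. -/
class IsLeftLeibniz (A : Type v) [NonUnitalNonAssocRing A] : Prop where
  leibniz : ∀ a b c : A, a * (b * c) = (a * b) * c + b * (a * c)

namespace Leibniz

variable {F : Type u} {A : Type v} [Field F] [NonUnitalNonAssocRing A] [Module F A]

/-- `C` is a (two-sided) ideal of the subalgebra `B`. -/
def IsIdealOf (C B : NonUnitalSubalgebra F A) : Prop :=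
  C ≤ B ∧ ∀ b ∈ B, ∀ c ∈ C, b * c ∈ C ∧ c * b ∈ C

variable [IsScalarTower F A A] [SMulCommClass F A A]

/-- `B` is subinvariant in `A`: there is a chain `B = chain t ⊆ ⋯ ⊆ chain 1 ⊆ chain 0 = A` of
subalgebras, each of which is an ideal of the preceding one `chain i`. -/
def IsSubinvariant (B : NonUnitalSubalgebra F A) : Prop :=
  ∃ (t : ℕ) (chain : ℕ → NonUnitalSubalgebra F A),
    chain 0 = ⊤ ∧ chain t = B ∧ ∀ i < t, IsIdealOf (chain (i + 1)) (chain i)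

/-- The subalgebra generated by all subinvariant subalgebras of `A` contained in `B`. -/
def subinvariantCore (B : NonUnitalSubalgebra F A) : NonUnitalSubalgebra F A :=
  NonUnitalAlgebra.adjoin F
    (⋃ C ∈ {C : NonUnitalSubalgebra F A | IsSubinvariant C ∧ C ≤ B}, (C : Set A))

end Leibniz

/-!
# Subinvariant subalgebras of Leibniz algebras in characteristic zero

Let `B` be a subalgebra of a finite-dimensional left Leibniz algebra `A` over a field of
characteristic zero. For a subinvariant subalgebra `C`, the decreasing series
`A ⊇ C * A ⊇ C * (C * A) ⊇ ⋯` eventually lies in `C`; its intersection, the nilpotent residual of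
`C`, is a two-sided ideal of `A` (`nilpotentResidual_mul_mem`, `mul_nilpotentResidual_mem`). Let `I`
be the sum of the residuals of all subinvariant `C ≤ B`, an ideal of `A` contained in `B`. Each such
`C` acts nilpotently on `A ⧸ I` by left multiplication.

For a subalgebra `C` acting on a vector space, let its radical consist of those `x ∈ C` whose
operator is orthogonal, under the trace form, to the associative algebra generated by `C`.
* The radical acts nilpotently: in characteristic zero the elements of that associative
  algebra orthogonal to it are nilpotent, and they form an ideal, which lies in its Jacobson radical
  (`isNilpotent_traceRadical`).
* The radical of an ideal `C'` of `C` is stable under `C`, by invariance of the trace form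
  (`mul_mem_actionRadical`).
* The radical contains every nilpotently acting ideal of `C` (`le_actionRadical`).

Climbing the chain of a nilpotently acting subinvariant subalgebra, it follows that this subalgebra
lies in the radical `J` of `A` (`IsSubinvariant.le_actionRadical_top`). Applied to the action on
`A ⧸ I`, this gives `C ≤ J ⊓ B` for all subinvariant `C ≤ B`. Since `J` is an ideal of `A`, the
subalgebra `J ⊓ B` is an ideal of `B`. It is also subinvariant in `A`: it contains `I`, hence a term
of the lower central series `J ⊇ J * J ⊇ J * (J * J) ⊇ ⋯`, and adding the terms of that series to it
gives the required chain (`isSubinvariant_of_leftPow_le`). So `J ⊓ B` is the core of `B`.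

For the last assertion, the algebra with basis `x, y, z` and the single nonzero product `x * y = z`
satisfies the Leibniz identity because all triple products vanish. The line spanned by `x` is an
ideal of the span of `x, z`, which is an ideal of `A`, but the line itself is not an ideal of `A`.
-/

namespace Leibniz

/-! ### Trace forms and nilpotent endomorphisms -/

section TraceForm

variable {F : Type*} [Field F]

/-- A subspace of a finite-dimensional algebra which is a left ideal of a subalgebra `E` and
consists of nilpotent elements is nilpotent: it lies in the Jacobson radical of `E`. -/
theorem isNilpotent_of_forall_isNilpotent {R : Type*} [Ring R] [Algebra F R]
    [FiniteDimensional F R] (E : Subalgebra F R) (U : Submodule F R)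
    (hUE : U ≤ Subalgebra.toSubmodule E) (hEU : ∀ y ∈ E, ∀ x ∈ U, y * x ∈ U)
    (hU : ∀ x ∈ U, IsNilpotent x) : IsNilpotent U := by
  have : IsArtinianRing E := IsArtinianRing.of_finite F E
  obtain ⟨n, hn⟩ := IsArtinianRing.isNilpotent_jacobson_bot (R := E)
  have hrad : ∀ x : E, (x : R) ∈ U → x ∈ (⊥ : Ideal E).jacobson := by
    refine fun x hx => Ideal.mem_jacobson_iff.2 fun y => ?_
    have hnil : IsNilpotent (y * x) := by
      obtain ⟨k, hk⟩ := hU _ (hEU y y.2 x hx)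
      exact ⟨k, Subtype.ext (by simpa using hk)⟩
    obtain ⟨z, hz⟩ := hnil.isUnit_one_add.exists_left_inv
    refine ⟨z, ?_⟩
    rw [Ideal.mem_bot, ← hz]
    noncomm_ring
  have hpow : ∀ k, ∀ x ∈ U ^ k, ∃ h : x ∈ E, (⟨x, h⟩ : E) ∈ (⊥ : Ideal E).jacobson ^ k := by
    intro k
    induction k with
    | zero =>
      intro x hx
      rw [pow_zero] at hx
      obtain ⟨r, rfl⟩ := Submodule.mem_one.1 hx
      exact ⟨E.algebraMap_mem r, by simp [Submodule.pow_zero]⟩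
    | succ k ih =>
      intro x hx
      rw [pow_succ] at hx
      refine Submodule.mul_induction_on hx (fun a ha b hb => ?_) ?_
      · obtain ⟨h, h'⟩ := ih a ha
        refine ⟨E.mul_mem h (hUE hb), ?_⟩
        rw [Submodule.pow_succ]
        exact Ideal.mul_mem_mul h' (hrad ⟨b, hUE hb⟩ hb)
      · rintro a b ⟨h, h'⟩ ⟨g, g'⟩
        exact ⟨E.add_mem h g, Ideal.add_mem _ h' g'⟩
  refine ⟨n, (Submodule.eq_bot_iff _).2 fun x hx => ?_⟩
  obtain ⟨h, h'⟩ := hpow n x hx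
  rw [hn] at h'
  exact congrArg Subtype.val ((Submodule.mem_bot _).1 h')

variable {V : Type*} [AddCommGroup V] [Module F V]

/-- In characteristic zero, an endomorphism all of whose multiples by polynomials in it are
traceless is nilpotent. -/
theorem isNilpotent_of_trace_mul_aeval_eq_zero [FiniteDimensional F V] [CharZero F]
    (x : Module.End F V)
    (h : ∀ p : Polynomial F, LinearMap.trace F V (x * Polynomial.aeval x p) = 0) :
    IsNilpotent x := by
  open Polynomial in
  have hm : minpoly F x ≠ 0 := minpoly.ne_zero (Algebra.IsIntegral.isIntegral x)
  obtain ⟨q, hq, hq0⟩ := Polynomial.exists_eq_pow_rootMultiplicity_mul_and_not_dvd _ hm 0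
  set k := (minpoly F x).rootMultiplicity 0
  rw [C_0, sub_zero] at hq hq0
  have hxq : x ^ k * aeval x q = 0 := by
    simpa [hq] using minpoly.aeval F x
  have hcop : IsCoprime (X ^ (k + 1) : F[X]) q :=
    ((Polynomial.irreducible_X.coprime_iff_not_dvd).2 hq0).pow_left
  obtain ⟨a, b, hab⟩ := hcop
  -- `e` is the projection onto the Fitting one-component of `x`.
  set e : Module.End F V := aeval x (a * X ^ (k + 1)) with he
  have he1 : e + aeval x (b * q) = 1 := by rw [he, ← map_add, hab, map_one]
  have hidem : IsIdempotentElem e := by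
    have : e * aeval x (b * q) = 0 := by
      rw [he, ← map_mul, show a * X ^ (k + 1) * (b * q) = a * X * b * (X ^ k * q) by ring, map_mul,
        map_mul (aeval x) (X ^ k) q]
      simp [hxq]
    rw [IsIdempotentElem]
    calc e * e = e * (e + aeval x (b * q)) := by rw [mul_add, this, add_zero]
      _ = e := by rw [he1, mul_one]
  have htr : LinearMap.trace F V e = 0 := by
    have := h (a * X ^ k)
    rwa [show x * aeval x (a * X ^ k) = e by
      rw [he, show a * X ^ (k + 1) = X * (a * X ^ k) by ring, map_mul _ X, aeval_X]] at this
  have he0 : e = 0 := by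
    have := (LinearMap.IsIdempotentElem.isProj_range e hidem).trace
    rw [htr] at this
    have h0 : Module.finrank F (LinearMap.range e) = 0 := by exact_mod_cast this.symm
    exact LinearMap.range_eq_bot.1 (Submodule.finrank_eq_zero.1 h0)
  refine ⟨k, ?_⟩
  rw [he0, zero_add] at he1
  calc x ^ k = x ^ k * aeval x (b * q) := by rw [he1, mul_one]
    _ = 0 := by rw [mul_comm b q, map_mul, ← mul_assoc, hxq, zero_mul]

/-- The elements of `E` orthogonal to `E` under the trace form. -/
def traceRadical (E : Subalgebra F (Module.End F V)) : Submodule F (Module.End F V) where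
  carrier := {x | x ∈ E ∧ ∀ y ∈ E, LinearMap.trace F V (x * y) = 0}
  add_mem' := fun ha hb => ⟨E.add_mem ha.1 hb.1, fun y hy => by
    rw [add_mul, map_add, ha.2 y hy, hb.2 y hy, add_zero]⟩
  zero_mem' := ⟨E.zero_mem, by simp⟩
  smul_mem' := fun r a ha => ⟨E.smul_mem ha.1 r, fun y hy => by
    rw [smul_mul_assoc, map_smul, ha.2 y hy, smul_zero]⟩

theorem isNilpotent_traceRadical [FiniteDimensional F V] [CharZero F]
    (E : Subalgebra F (Module.End F V)) :
    IsNilpotent (traceRadical E) := by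
  refine isNilpotent_of_forall_isNilpotent E _ (fun x hx => hx.1) ?_ ?_
  · refine fun y hy x hx => ⟨E.mul_mem hy hx.1, fun z hz => ?_⟩
    rw [mul_assoc, LinearMap.trace_mul_comm, mul_assoc]
    exact hx.2 _ (E.mul_mem hz hy)
  · refine fun x hx => isNilpotent_of_trace_mul_aeval_eq_zero x fun p => hx.2 _ ?_
    exact Algebra.adjoin_le (Set.singleton_subset_iff.2 hx.1)
      (Polynomial.aeval_mem_adjoin_singleton F x)

/-- In an ordered semiring, powers of `u * e` are collected as `e * u ^ n` if `u` can be moved past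
the idempotent `e`. -/
theorem mul_pow_le_mul_pow {M : Type*} [IdemSemiring M] {e u : M} (h1 : 1 ≤ e) (he : e * e = e)
    (hue : u * e ≤ e * u) (n : ℕ) : (u * e) ^ n ≤ e * u ^ n := by
  have hswap : ∀ n, u ^ n * e ≤ e * u ^ n := by
    intro n
    induction n with
    | zero => simp
    | succ n ih =>
      calc u ^ (n + 1) * e = u ^ n * (u * e) := by rw [pow_succ, mul_assoc]
        _ ≤ u ^ n * (e * u) := by gcongr
        _ = u ^ n * e * u := by rw [mul_assoc]
        _ ≤ e * u ^ n * u := by gcongr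
        _ = e * u ^ (n + 1) := by rw [pow_succ, mul_assoc]
  induction n with
  | zero => simpa using h1
  | succ n ih =>
    calc (u * e) ^ (n + 1) = (u * e) ^ n * (u * e) := pow_succ _ _
      _ ≤ e * u ^ n * (u * e) := by gcongr
      _ = e * (u ^ (n + 1) * e) := by rw [pow_succ]; simp only [mul_assoc]
      _ ≤ e * (e * u ^ (n + 1)) := by gcongr e * ?_; exact hswap _
      _ = e * u ^ (n + 1) := by rw [← mul_assoc, he]

/-- If `[c, U] ⊆ U` for all `c ∈ S` and the subspace `U` is nilpotent, then `u * y` is traceless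
for every `u ∈ U` and every `y` in the associative algebra generated by `S`, because the powers of
`U` can be collected on the right. -/
theorem trace_mul_eq_zero_of_isNilpotent {S : Set (Module.End F V)}
    {U : Submodule F (Module.End F V)} (hU : IsNilpotent U)
    (hSU : ∀ c ∈ S, ∀ u ∈ U, u * c - c * u ∈ U) {u y : Module.End F V} (hu : u ∈ U)
    (hy : y ∈ Algebra.adjoin F S) : LinearMap.trace F V (u * y) = 0 := by
  set E : Submodule F (Module.End F V) := Subalgebra.toSubmodule (Algebra.adjoin F S) with hE
  have hEE : E * E = E := Subalgebra.isIdempotentElem_toSubmodule _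
  have hE1 : 1 ≤ E := Submodule.one_le.2 (Subalgebra.one_mem _)
  have hswap : U * E ≤ E * U := by
    refine Submodule.mul_le.2 fun v hv z hz => ?_
    revert v
    refine Algebra.adjoin_induction (p := fun z _ => ∀ v ∈ U, v * z ∈ E * U) ?_ ?_ ?_ ?_ hz
    · intro c hc v hv
      rw [← sub_add_cancel (v * c) (c * v), ← one_mul (v * c - c * v)]
      exact add_mem (Submodule.mul_mem_mul (Subalgebra.one_mem _) (hSU c hc v hv))
        (Submodule.mul_mem_mul (Algebra.subset_adjoin hc) hv)
    · intro r v hv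
      rw [← Algebra.commutes]
      exact Submodule.mul_mem_mul (Subalgebra.algebraMap_mem _ r) hv
    · intro a b _ _ ha hb v hv
      rw [mul_add]
      exact add_mem (ha v hv) (hb v hv)
    · intro a b _ _ ha hb v hv
      rw [← mul_assoc]
      refine Submodule.mul_induction_on (ha v hv) (fun m hm n hn => ?_) fun m n hm hn => ?_
      · rw [mul_assoc, ← hEE, mul_assoc E]
        exact Submodule.mul_mem_mul hm (hb n hn)
      · rw [add_mul]
        exact add_mem hm hn
  obtain ⟨n, hn⟩ := hU
  have hnil : IsNilpotent (u * y) := by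
    refine ⟨n, ?_⟩
    have := mul_pow_le_mul_pow hE1 hEE hswap n
      (Submodule.pow_mem_pow _ (Submodule.mul_mem_mul hu hy) n)
    simpa [hn] using this
  exact (LinearMap.isNilpotent_trace_of_isNilpotent hnil).eq_zero

end TraceForm

/-! ### The radical of an algebra acting on a vector space -/

section Representation

variable {F A V : Type*} [Field F] [NonUnitalNonAssocRing A] [Module F A]
  [AddCommGroup V] [Module F V]

/-- The elements `x` of the subalgebra `C` such that `ρ x` lies in the trace radical of the
associative algebra generated by `ρ(C)`. -/
def actionRadical (ρ : A →ₗ[F] Module.End F V) (C : NonUnitalSubalgebra F A) : Submodule F A :=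
  C.toSubmodule ⊓ (traceRadical (Algebra.adjoin F (ρ '' C))).comap ρ

variable {ρ : A →ₗ[F] Module.End F V}

theorem mem_actionRadical {C : NonUnitalSubalgebra F A} {x : A} : x ∈ actionRadical ρ C ↔
    x ∈ C ∧ ∀ y ∈ Algebra.adjoin F (ρ '' C), LinearMap.trace F V (ρ x * y) = 0 :=
  ⟨fun h => ⟨h.1, h.2.2⟩,
    fun h => ⟨h.1, Algebra.subset_adjoin (Set.mem_image_of_mem _ h.1), h.2⟩⟩

theorem isNilpotent_map_actionRadical [FiniteDimensional F V] [CharZero F]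
    (C : NonUnitalSubalgebra F A) : IsNilpotent ((actionRadical ρ C).map ρ) := by
  obtain ⟨n, hn⟩ := isNilpotent_traceRadical (Algebra.adjoin F (ρ '' C))
  refine ⟨n, le_bot_iff.1 ?_⟩
  calc (actionRadical ρ C).map ρ ^ n ≤ traceRadical (Algebra.adjoin F (ρ '' C)) ^ n :=
        pow_le_pow_left' (Submodule.map_le_iff_le_comap.2 inf_le_right) n
    _ = ⊥ := hn

/-- The radical of an ideal `C'` of `C` is stable under `C`: commuting with `ρ a` for `a ∈ C` is a
derivation of the associative algebra generated by `ρ(C')`, and the trace form is invariant. -/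
theorem mul_mem_actionRadical (hρ : ∀ a b, ρ (a * b) = ρ a * ρ b - ρ b * ρ a)
    {C C' : NonUnitalSubalgebra F A} (h : IsIdealOf C' C) {a x : A} (ha : a ∈ C)
    (hx : x ∈ actionRadical ρ C') : a * x ∈ actionRadical ρ C' ∧ x * a ∈ actionRadical ρ C' := by
  rw [mem_actionRadical] at hx
  have hder : ∀ y ∈ Algebra.adjoin F (ρ '' C'), ρ a * y - y * ρ a ∈ Algebra.adjoin F (ρ '' C') := by
    intro y hy
    refine Algebra.adjoin_induction
      (p := fun y _ => ρ a * y - y * ρ a ∈ Algebra.adjoin F (ρ '' C')) ?_ ?_ ?_ ?_ hy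
    · rintro _ ⟨c, hc, rfl⟩
      rw [← hρ]
      exact Algebra.subset_adjoin (Set.mem_image_of_mem _ (h.2 a ha c hc).1)
    · intro r
      rw [Algebra.commutes, sub_self]
      exact Subalgebra.zero_mem _
    · intro y z _ _ hy hz
      rw [mul_add, add_mul, add_sub_add_comm]
      exact add_mem hy hz
    · intro y z hy' hz' hy hz
      rw [show ρ a * (y * z) - y * z * ρ a = (ρ a * y - y * ρ a) * z + y * (ρ a * z - z * ρ a) by
        noncomm_ring]
      exact add_mem (mul_mem hy hz') (mul_mem hy' hz)
  have htr : ∀ y ∈ Algebra.adjoin F (ρ '' C'), LinearMap.trace F V (ρ (a * x) * y) = 0 := by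
    intro y hy
    have h1 := hx.2 _ (hder y hy)
    rw [mul_sub, map_sub, sub_eq_zero, ← mul_assoc, ← mul_assoc] at h1
    rw [hρ, sub_mul, map_sub, sub_eq_zero, h1, mul_assoc, LinearMap.trace_mul_comm]
  refine ⟨mem_actionRadical.2 ⟨(h.2 a ha x hx.1).1, htr⟩,
    mem_actionRadical.2 ⟨(h.2 a ha x hx.1).2, fun y hy => ?_⟩⟩
  rw [show ρ (x * a) = -ρ (a * x) by rw [hρ, hρ, neg_sub], neg_mul, map_neg, htr y hy, neg_zero]

/-- The radical of `C` contains every subspace of `C` that is stable under left multiplication by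
`C` and acts nilpotently. -/
theorem le_actionRadical (hρ : ∀ a b, ρ (a * b) = ρ a * ρ b - ρ b * ρ a)
    {C : NonUnitalSubalgebra F A} {X : Submodule F A} (hXC : X ≤ C.toSubmodule)
    (hCX : ∀ a ∈ C, ∀ x ∈ X, a * x ∈ X) (hX : IsNilpotent (X.map ρ)) :
    X ≤ actionRadical ρ C := by
  refine fun x hx => mem_actionRadical.2 ⟨hXC hx, fun y hy =>
    trace_mul_eq_zero_of_isNilpotent hX ?_ (Submodule.mem_map_of_mem hx) hy⟩
  rintro _ ⟨c, hc, rfl⟩ _ ⟨z, hz, rfl⟩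
  rw [← neg_sub, ← hρ, ← map_neg]
  exact Submodule.mem_map_of_mem (neg_mem (hCX c hc z hz))

/-- A subinvariant subalgebra acting nilpotently lies in the radical of the whole algebra: along the
chain, the radical of each term is a nilpotently acting ideal of the preceding term. -/
theorem IsSubinvariant.le_actionRadical_top [FiniteDimensional F V] [CharZero F]
    (hρ : ∀ a b, ρ (a * b) = ρ a * ρ b - ρ b * ρ a) [IsScalarTower F A A] [SMulCommClass F A A]
    {C : NonUnitalSubalgebra F A} (hC : IsSubinvariant C)
    (hnil : IsNilpotent (C.toSubmodule.map ρ)) : C.toSubmodule ≤ actionRadical ρ ⊤ := by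
  obtain ⟨t, chain, h0, ht, hchain⟩ := hC
  rw [← h0]
  refine Nat.decreasingInduction' (P := fun i => C.toSubmodule ≤ actionRadical ρ (chain i))
    (fun i hi _ ih => ih.trans ?_) (Nat.zero_le t) ?_
  · exact le_actionRadical hρ (inf_le_left.trans (hchain i hi).1)
      (fun a ha x hx => (mul_mem_actionRadical hρ (hchain i hi) ha hx).1)
      (isNilpotent_map_actionRadical _)
  · rw [ht]
    exact le_actionRadical hρ le_rfl (fun a ha x hx => C.mul_mem ha hx) hnil

end Representation

/-! ### Iterated left products and nilpotent residuals -/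

theorem le_of_isIdealOf_chain {F A : Type*} [Field F] [NonUnitalNonAssocRing A] [Module F A]
    {t : ℕ} {chain : ℕ → NonUnitalSubalgebra F A}
    (hchain : ∀ i < t, IsIdealOf (chain (i + 1)) (chain i)) {i : ℕ} (hi : i ≤ t) :
    chain t ≤ chain i :=
  Nat.decreasingInduction' (P := fun i => chain t ≤ chain i)
    (fun j hj _ ih => (hchain j hj).1.trans' ih) hi le_rfl

section LeftPow

variable {F A : Type*} [Field F] [NonUnitalNonAssocRing A] [Module F A]
  [IsScalarTower F A A] [SMulCommClass F A A]

/-- The span of the products `c₁ * (c₂ * (⋯ * (cₙ * s)))` with `cᵢ ∈ C` and `s ∈ S`. -/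
def leftPow (C S : Submodule F A) : ℕ → Submodule F A
  | 0 => S
  | n + 1 => Submodule.map₂ (LinearMap.mul F A) C (leftPow C S n)

theorem mul_mem_leftPow {C S : Submodule F A} {n : ℕ} {c x : A} (hc : c ∈ C)
    (hx : x ∈ leftPow C S n) : c * x ∈ leftPow C S (n + 1) :=
  Submodule.apply_mem_map₂ (LinearMap.mul F A) hc hx

theorem leftPow_succ_le {C S P : Submodule F A} {n : ℕ}
    (h : ∀ c ∈ C, ∀ x ∈ leftPow C S n, c * x ∈ P) : leftPow C S (n + 1) ≤ P :=
  Submodule.map₂_le.2 h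

theorem leftPow_antitone {C S : Submodule F A} (h : leftPow C S 1 ≤ S) :
    Antitone (leftPow C S) := by
  refine antitone_nat_of_succ_le fun n => ?_
  induction n with
  | zero => exact h
  | succ n ih => exact Submodule.map₂_le_map₂_right ih

theorem leftPow_mono_right {C S T : Submodule F A} (h : S ≤ T) (n : ℕ) :
    leftPow C S n ≤ leftPow C T n := by
  induction n with
  | zero => exact h
  | succ n ih => exact Submodule.map₂_le_map₂_right ih

/-- The intersection of the subspaces spanned by the products `c₁ * (⋯ * (cₙ * a))` with `cᵢ ∈ C`
and `a ∈ A`. For a subinvariant subalgebra it is the last term of the lower central series. -/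
def nilpotentResidual (C : Submodule F A) : Submodule F A := ⨅ n, leftPow C ⊤ n

theorem exists_leftPow_eq_nilpotentResidual [FiniteDimensional F A] (C : Submodule F A) :
    ∃ n, ∀ m, n ≤ m → leftPow C ⊤ m = nilpotentResidual C := by
  have hanti : Antitone (leftPow C ⊤) := leftPow_antitone le_top
  obtain ⟨n, hn⟩ := IsArtinian.monotone_stabilizes (R := F) (M := A)
    ⟨fun n => OrderDual.toDual (leftPow C ⊤ n), hanti⟩
  have hn' : ∀ m, n ≤ m → leftPow C ⊤ n = leftPow C ⊤ m := hn
  have hres : leftPow C ⊤ n = nilpotentResidual C := by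
    refine le_antisymm (le_iInf fun m => ?_) (iInf_le _ n)
    rw [hn' (max n m) (le_max_left _ _)]
    exact hanti (le_max_right _ _)
  exact ⟨n, fun m hm => (hn' m hm).symm.trans hres⟩

theorem nilpotentResidual_eq_map₂ [FiniteDimensional F A] (C : Submodule F A) :
    nilpotentResidual C = Submodule.map₂ (LinearMap.mul F A) C (nilpotentResidual C) := by
  obtain ⟨n, hn⟩ := exists_leftPow_eq_nilpotentResidual C
  conv_lhs => rw [← hn (n + 1) (Nat.le_succ n)]
  rw [leftPow, hn n le_rfl]

theorem nilpotentResidual_le_of_mul_mem [FiniteDimensional F A] {C P : Submodule F A}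
    (h : ∀ c ∈ C, ∀ d ∈ nilpotentResidual C, c * d ∈ P) : nilpotentResidual C ≤ P := by
  rw [nilpotentResidual_eq_map₂]
  exact Submodule.map₂_le.2 h

theorem nilpotentResidual_le_of_isSubinvariant {C : NonUnitalSubalgebra F A}
    (hC : IsSubinvariant C) : nilpotentResidual C.toSubmodule ≤ C.toSubmodule := by
  obtain ⟨t, chain, h0, ht, hchain⟩ := hC
  have hle : ∀ i, i ≤ t → C ≤ chain i := fun i hi => ht ▸ le_of_isIdealOf_chain hchain hi
  have hpow : ∀ i, i ≤ t → leftPow C.toSubmodule ⊤ i ≤ (chain i).toSubmodule := by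
    intro i
    induction i with
    | zero => simp [h0]
    | succ i ih => exact fun hi => leftPow_succ_le fun c hc x hx =>
        ((hchain i hi).2 x (ih (Nat.le_of_succ_le hi) hx) c (hle (i + 1) hi hc)).2
  exact (iInf_le _ t).trans (ht ▸ hpow t le_rfl)

variable [IsLeftLeibniz A]

theorem mul_mul_eq_sub (a b c : A) : (a * b) * c = a * (b * c) - b * (a * c) := by
  rw [IsLeftLeibniz.leibniz, add_sub_cancel_right]

/-- The residual `D` is a right ideal: since `D = C * D`, the product `D * a` can be pushed
arbitrarily far down the series `C * (⋯ * (C * A))`. -/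
theorem nilpotentResidual_mul_mem [FiniteDimensional F A] {C : Submodule F A}
    (hC : nilpotentResidual C ≤ C) {d : A}
    (hd : d ∈ nilpotentResidual C) (a : A) : d * a ∈ nilpotentResidual C := by
  have key : ∀ n m, ∀ x ∈ leftPow C ⊤ m, ∀ d ∈ nilpotentResidual C,
      d * x ∈ leftPow C ⊤ (m + n) := by
    intro n
    induction n with
    | zero =>
      intro m x hx d hd
      exact leftPow_antitone (S := ⊤) le_top (Nat.le_succ m) (mul_mem_leftPow (hC hd) hx)
    | succ n ih =>
      intro m x hx d hd
      refine nilpotentResidual_le_of_mul_mem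
        (P := (leftPow C ⊤ (m + (n + 1))).comap (LinearMap.mulRight F x)) (fun c hc d hd => ?_) hd
      rw [Submodule.mem_comap, LinearMap.mulRight_apply, mul_mul_eq_sub]
      refine sub_mem (mul_mem_leftPow hc (ih m x hx d hd)) ?_
      rw [Nat.add_comm n 1, ← Nat.add_assoc]
      exact ih (m + 1) _ (mul_mem_leftPow hc hx) d hd
  refine (Submodule.mem_iInf _).2 fun n => ?_
  simpa using key n 0 a trivial d hd

/-- The residual of a subinvariant subalgebra is a left ideal of the whole algebra. The proof
descends along the chain `C = Cₜ ⊆ ⋯ ⊆ C₀ = A`, using `x * (c * d) = (x * c) * d + c * (x * d)`,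
where `x * c` lies one step lower in the chain. -/
theorem mul_nilpotentResidual_mem [FiniteDimensional F A] {C : NonUnitalSubalgebra F A}
    (hC : IsSubinvariant C) {d : A}
    (hd : d ∈ nilpotentResidual C.toSubmodule) (a : A) :
    a * d ∈ nilpotentResidual C.toSubmodule := by
  obtain ⟨t, chain, h0, ht, hchain⟩ := hC
  have hle : ∀ i, i ≤ t → C ≤ chain i := fun i hi => ht ▸ le_of_isIdealOf_chain hchain hi
  have key : ∀ x ∈ chain 0, ∀ d ∈ nilpotentResidual C.toSubmodule,
      x * d ∈ nilpotentResidual C.toSubmodule := by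
    refine Nat.decreasingInduction' (P := fun i => ∀ x ∈ chain i,
      ∀ d ∈ nilpotentResidual C.toSubmodule, x * d ∈ nilpotentResidual C.toSubmodule)
      (fun i hi _ ih x hx d hd => ?_) (Nat.zero_le t) ?_
    · refine (Submodule.mem_iInf _).2 fun n => ?_
      induction n generalizing d with
      | zero => trivial
      | succ n ihn =>
        refine nilpotentResidual_le_of_mul_mem (P := (leftPow C.toSubmodule ⊤ (n + 1)).comap
          (LinearMap.mulLeft F x)) (fun c hc d hd => ?_) hd
        rw [Submodule.mem_comap, LinearMap.mulLeft_apply, IsLeftLeibniz.leibniz]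
        refine add_mem ?_ (mul_mem_leftPow hc (ihn d hd))
        exact (Submodule.mem_iInf _).1
          (ih _ ((hchain i hi).2 x hx c (hle (i + 1) hi hc)).1 d hd) (n + 1)
    · intro x hx d hd
      rw [ht] at hx
      rw [nilpotentResidual_eq_map₂]
      exact Submodule.apply_mem_map₂ (LinearMap.mul F A) hx hd
  exact key a (h0 ▸ trivial) d hd

end LeftPow

/-! ### The action on the quotient by a left ideal -/

section Quotient

variable {F A : Type*} [Field F] [NonUnitalNonAssocRing A] [Module F A]
  [IsScalarTower F A A] [SMulCommClass F A A]

/-- Left multiplication of `A` on the quotient space by a left ideal `I`. -/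
def quotientAction (I : Submodule F A) (hI : ∀ a, ∀ x ∈ I, a * x ∈ I) :
    A →ₗ[F] Module.End F (A ⧸ I) where
  toFun a := I.mapQ I (LinearMap.mulLeft F a) (hI a)
  map_add' a b := by
    ext x
    exact congrArg Submodule.Quotient.mk (add_mul a b x)
  map_smul' r a := by
    ext x
    exact congrArg Submodule.Quotient.mk (smul_mul_assoc r a x)

variable {I : Submodule F A} {hI : ∀ a, ∀ x ∈ I, a * x ∈ I}

@[simp]
theorem quotientAction_mk (a x : A) :
    quotientAction I hI a (Submodule.Quotient.mk x) = Submodule.Quotient.mk (a * x) := rfl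

theorem quotientAction_mul [IsLeftLeibniz A] (a b : A) :
    quotientAction I hI (a * b) = quotientAction I hI a * quotientAction I hI b -
      quotientAction I hI b * quotientAction I hI a := by
  ext x
  simp [mul_mul_eq_sub]

/-- The `n`-fold products of operators from `X` vanish on `A ⧸ I` exactly when all products
`c₁ * (⋯ * (cₙ * a))` with `cᵢ ∈ X` lie in `I`. -/
theorem map_quotientAction_pow_eq_bot_iff {X : Submodule F A} {n : ℕ} :
    X.map (quotientAction I hI) ^ n = ⊥ ↔ leftPow X ⊤ n ≤ I := by
  constructor
  · intro h
    -- Factors are moved one at a time from the vector to the operator.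
    have key : ∀ k j, k + j = n → ∀ d ∈ leftPow X ⊤ k, ∀ u ∈ X.map (quotientAction I hI) ^ j,
        u (Submodule.Quotient.mk d) = 0 := by
      intro k
      induction k with
      | zero =>
        intro j hj d _ u hu
        rw [← hj, zero_add] at h
        rw [h, Submodule.mem_bot] at hu
        rw [hu, LinearMap.zero_apply]
      | succ k ih =>
        intro j hj d hd u hu
        suffices leftPow X ⊤ (k + 1) ≤ LinearMap.ker (u ∘ₗ I.mkQ) from this hd
        refine leftPow_succ_le fun x hx e he => ?_
        refine ih (j + 1) (by lia) e he (u * quotientAction I hI x) ?_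
        rw [pow_succ]
        exact Submodule.mul_mem_mul hu (Submodule.mem_map_of_mem hx)
    exact fun d hd => (Submodule.Quotient.mk_eq_zero I).1
      (key n 0 (add_zero n) d hd 1 (Submodule.one_le.1 (pow_zero _).ge))
  · intro h
    have key : ∀ k, ∀ u ∈ X.map (quotientAction I hI) ^ k, ∀ a : A,
        u (Submodule.Quotient.mk a) ∈ (leftPow X ⊤ k).map I.mkQ := by
      intro k
      induction k with
      | zero =>
        intro u _ a
        obtain ⟨b, hb⟩ := I.mkQ_surjective (u (Submodule.Quotient.mk a))
        exact ⟨b, trivial, hb⟩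
      | succ k ih =>
        intro u hu a
        rw [pow_succ'] at hu
        refine Submodule.mul_induction_on hu ?_ fun v w hv hw => add_mem hv hw
        rintro _ ⟨x, hx, rfl⟩ v hv
        obtain ⟨d, hd, hd'⟩ := ih v hv a
        exact ⟨x * d, mul_mem_leftPow hx hd, by
          rw [Module.End.mul_apply, ← hd']
          rfl⟩
    refine (Submodule.eq_bot_iff _).2 fun u hu => ?_
    ext a
    obtain ⟨d, hd, hd'⟩ := key n u hu a
    exact hd'.symm.trans ((Submodule.Quotient.mk_eq_zero I).2 (h hd))

end Quotient

/-! ### The largest subinvariant subalgebra inside a subalgebra -/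

section Main

variable {F A : Type*} [Field F] [NonUnitalNonAssocRing A] [Module F A]
  [IsScalarTower F A A] [SMulCommClass F A A] [IsLeftLeibniz A]

theorem leftPow_self_mul_mem {J : Submodule F A} {k m : ℕ} {x y : A} (hx : x ∈ leftPow J J k)
    (hy : y ∈ leftPow J J m) : x * y ∈ leftPow J J (k + m + 1) := by
  induction k generalizing m x y with
  | zero =>
    rw [zero_add]
    exact mul_mem_leftPow hx hy
  | succ k ih =>
    refine leftPow_succ_le (P := (leftPow J J (k + 1 + m + 1)).comap (LinearMap.mulRight F y))
      (fun j hj d hd => ?_) hx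
    rw [Submodule.mem_comap, LinearMap.mulRight_apply, mul_mul_eq_sub]
    rw [show k + 1 + m = k + m + 1 by lia]
    refine sub_mem (mul_mem_leftPow hj (ih hd hy)) ?_
    have := ih hd (mul_mem_leftPow hj hy)
    rwa [← add_assoc] at this

/-- If `J` is an ideal of `A` and the subalgebra `M ⊆ J` contains a term of the lower central
series of `J`, then `M` is subinvariant: the sums of `M` with the terms of that series form a
chain. -/
theorem isSubinvariant_of_leftPow_le {J : Submodule F A}
    (hJ : ∀ a, ∀ x ∈ J, a * x ∈ J ∧ x * a ∈ J) {M : NonUnitalSubalgebra F A}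
    (hMJ : M.toSubmodule ≤ J) {n : ℕ} (hn : leftPow J J n ≤ M.toSubmodule) :
    IsSubinvariant M := by
  have hanti : Antitone (leftPow J J) :=
    leftPow_antitone (leftPow_succ_le fun c _ x hx => (hJ c x hx).1)
  have hmul : ∀ k, ∀ b ∈ M.toSubmodule ⊔ leftPow J J k, ∀ c ∈ M.toSubmodule ⊔ leftPow J J k,
      b * c ∈ M.toSubmodule ⊔ leftPow J J (k + 1) := by
    intro k b hb c hc
    obtain ⟨m, hm, p, hp, rfl⟩ := Submodule.mem_sup.1 hb
    obtain ⟨m', hm', q, hq, rfl⟩ := Submodule.mem_sup.1 hc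
    rw [add_mul, mul_add, add_assoc]
    refine add_mem (Submodule.mem_sup_left (M.mul_mem hm hm')) (Submodule.mem_sup_right ?_)
    refine add_mem (mul_mem_leftPow (hMJ hm) hq) ?_
    exact leftPow_self_mul_mem (m := 0) hp
      (add_mem (hMJ hm') (hanti (Nat.zero_le k) hq))
  have hle : ∀ k, M.toSubmodule ⊔ leftPow J J (k + 1) ≤ M.toSubmodule ⊔ leftPow J J k :=
    fun k => sup_le_sup_left (hanti (Nat.le_succ k)) _
  let S : ℕ → NonUnitalSubalgebra F A := fun k =>
    { M.toSubmodule ⊔ leftPow J J k with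
      mul_mem' := fun {b c} hb hc => hle k (hmul k b hb c hc) }
  have hS : ∀ k x, x ∈ S k ↔ x ∈ M.toSubmodule ⊔ leftPow J J k := fun _ _ => Iff.rfl
  refine ⟨n + 1, fun i => Nat.casesOn i ⊤ S, rfl, ?_, ?_⟩
  · ext x
    rw [hS, sup_eq_left.2 hn]
    rfl
  · rintro (_ | i) _
    · refine ⟨le_top, fun b _ c hc => ?_⟩
      have hJ0 : M.toSubmodule ⊔ leftPow J J 0 = J := sup_eq_right.2 hMJ
      simp only [hS, hJ0] at hc ⊢
      exact hJ b c hc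
    · exact ⟨hle i, fun b hb c hc => ⟨hmul i b hb c (hle i hc), hmul i c (hle i hc) b hb⟩⟩

/-- Every subinvariant subalgebra of `A` contained in `B` lies in one that is an ideal of `B`,
namely the intersection of `B` with the radical of `A` for the action on `A ⧸ I`, where `I` is the
sum of the nilpotent residuals. -/
theorem exists_isSubinvariant_isIdealOf [CharZero F] [FiniteDimensional F A]
    (B : NonUnitalSubalgebra F A) :
    ∃ M : NonUnitalSubalgebra F A, IsSubinvariant M ∧ IsIdealOf M B ∧
      ∀ C : NonUnitalSubalgebra F A, IsSubinvariant C → C ≤ B → C ≤ M := by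
  let I : Submodule F A :=
    ⨆ C ∈ {C : NonUnitalSubalgebra F A | IsSubinvariant C ∧ C ≤ B}, nilpotentResidual C.toSubmodule
  have hres : ∀ C : NonUnitalSubalgebra F A, IsSubinvariant C → C ≤ B →
      nilpotentResidual C.toSubmodule ≤ I := fun C hC hCB =>
    le_iSup₂_of_le (f := fun (C : NonUnitalSubalgebra F A)
      (_ : C ∈ {C : NonUnitalSubalgebra F A | IsSubinvariant C ∧ C ≤ B}) =>
        nilpotentResidual C.toSubmodule) C ⟨hC, hCB⟩ le_rfl
  have hIB : I ≤ B.toSubmodule :=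
    iSup₂_le fun C hC => (nilpotentResidual_le_of_isSubinvariant hC.1).trans hC.2
  have hI : ∀ a, ∀ x ∈ I, a * x ∈ I := fun a => by
    change I ≤ I.comap (LinearMap.mulLeft F a)
    exact iSup₂_le fun C hC d hd => hres C hC.1 hC.2 (mul_nilpotentResidual_mem hC.1 hd a)
  have hI' : ∀ a, ∀ x ∈ I, x * a ∈ I := fun a => by
    change I ≤ I.comap (LinearMap.mulRight F a)
    exact iSup₂_le fun C hC d hd => hres C hC.1 hC.2
      (nilpotentResidual_mul_mem (nilpotentResidual_le_of_isSubinvariant hC.1) hd a)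
  let ρ := quotientAction I hI
  have hρ : ∀ a b, ρ (a * b) = ρ a * ρ b - ρ b * ρ a := quotientAction_mul
  -- `J` contains every `C` below, is an ideal of `A`, and is nilpotent modulo `I`.
  let J := actionRadical ρ ⊤
  have hJ : ∀ a, ∀ x ∈ J, a * x ∈ J ∧ x * a ∈ J := fun a x hx =>
    mul_mem_actionRadical hρ
      ⟨le_rfl, fun _ _ _ _ => ⟨NonUnitalAlgebra.mem_top, NonUnitalAlgebra.mem_top⟩⟩
      NonUnitalAlgebra.mem_top hx
  have hIJ : I ≤ J := fun x hx => by
    have h0 : ρ x = 0 := by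
      ext a
      exact (Submodule.Quotient.mk_eq_zero I).2 (hI' a x hx)
    exact mem_actionRadical.2 ⟨NonUnitalAlgebra.mem_top, fun y _ => by rw [h0, zero_mul, map_zero]⟩
  obtain ⟨n, hn⟩ : IsNilpotent (J.map ρ) := isNilpotent_map_actionRadical _
  let M : NonUnitalSubalgebra F A :=
    { J ⊓ B.toSubmodule with
      mul_mem' := fun {b c} hb hc => ⟨(hJ b c hc.1).1, B.mul_mem hb.2 hc.2⟩ }
  refine ⟨M, isSubinvariant_of_leftPow_le (n := n) hJ (fun x hx => hx.1) ?_,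
    ⟨fun x hx => hx.2, ?_⟩, ?_⟩
  · exact (leftPow_mono_right le_top n).trans
      ((map_quotientAction_pow_eq_bot_iff.1 hn).trans (le_inf hIJ hIB))
  · exact fun b hb c hc => ⟨⟨(hJ b c hc.1).1, B.mul_mem hb hc.2⟩,
      ⟨(hJ b c hc.1).2, B.mul_mem hc.2 hb⟩⟩
  · intro C hC hCB x hx
    refine ⟨hC.le_actionRadical_top hρ ?_ hx, hCB hx⟩
    obtain ⟨k, hk⟩ := exists_leftPow_eq_nilpotentResidual C.toSubmodule
    exact ⟨k, map_quotientAction_pow_eq_bot_iff.2 ((hk k le_rfl).le.trans (hres C hC hCB))⟩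

end Main

/-! ### A subinvariant subalgebra that is not an ideal -/

section Counterexample

/-- The three-dimensional algebra with basis `x, y, z` whose only nonzero product of basis vectors
is `x * y = z`, in coordinates. -/
def StepTwo (F : Type u) : Type u := F × F × F

namespace StepTwo

variable (F : Type u) [Field F]

instance : AddCommGroup (StepTwo F) := inferInstanceAs (AddCommGroup (F × F × F))

instance : Module F (StepTwo F) := inferInstanceAs (Module F (F × F × F))

instance : FiniteDimensional F (StepTwo F) := inferInstanceAs (FiniteDimensional F (F × F × F))

instance : NonUnitalNonAssocRing (StepTwo F) where
  mul a b := ((0, 0, a.1 * b.2.1) : F × F × F)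
  left_distrib a b c := Prod.ext (add_zero _).symm
    (Prod.ext (add_zero _).symm (mul_add a.1 b.2.1 c.2.1))
  right_distrib a b c := Prod.ext (add_zero _).symm
    (Prod.ext (add_zero _).symm (add_mul a.1 b.1 c.2.1))
  zero_mul a := Prod.ext rfl (Prod.ext rfl (zero_mul a.2.1))
  mul_zero a := Prod.ext rfl (Prod.ext rfl (mul_zero a.1))

variable {F}

instance : IsScalarTower F (StepTwo F) (StepTwo F) :=
  ⟨fun r a b => Prod.ext (mul_zero r).symm (Prod.ext (mul_zero r).symm (mul_assoc r a.1 b.2.1))⟩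

instance : SMulCommClass F (StepTwo F) (StepTwo F) :=
  ⟨fun r a b => Prod.ext (mul_zero r) (Prod.ext (mul_zero r) (mul_left_comm r a.1 b.2.1))⟩

instance : IsLeftLeibniz (StepTwo F) :=
  ⟨fun a b c => Prod.ext (add_zero _).symm (Prod.ext (add_zero _).symm
    (show a.1 * 0 = 0 * c.2.1 + b.1 * 0 by ring))⟩

variable (F)

/-- The span of `x` and `z`. -/
def plane : NonUnitalSubalgebra F (StepTwo F) where
  carrier := {a | a.2.1 = 0}
  add_mem' {a b} ha hb := show a.2.1 + b.2.1 = 0 by rw [ha, hb, add_zero]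
  zero_mem' := rfl
  smul_mem' r a ha := show r * a.2.1 = 0 by rw [ha, mul_zero]
  mul_mem' _ _ := rfl

/-- The span of `x`. -/
def line : NonUnitalSubalgebra F (StepTwo F) where
  carrier := {a | a.2.1 = 0 ∧ a.2.2 = 0}
  add_mem' {a b} ha hb := ⟨show a.2.1 + b.2.1 = 0 by rw [ha.1, hb.1, add_zero],
    show a.2.2 + b.2.2 = 0 by rw [ha.2, hb.2, add_zero]⟩
  zero_mem' := ⟨rfl, rfl⟩
  smul_mem' r a ha := ⟨show r * a.2.1 = 0 by rw [ha.1, mul_zero],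
    show r * a.2.2 = 0 by rw [ha.2, mul_zero]⟩
  mul_mem' {a b} _ hb := ⟨rfl, show a.1 * b.2.1 = 0 by rw [hb.1, mul_zero]⟩

theorem isSubinvariant_line : IsSubinvariant (line F) := by
  refine ⟨2, fun i => Nat.casesOn i ⊤ fun j => Nat.casesOn j (plane F) fun _ => line F,
    rfl, rfl, fun i hi => ?_⟩
  obtain rfl | rfl : i = 0 ∨ i = 1 := by lia
  · exact ⟨le_top, fun _ _ _ _ => ⟨rfl, rfl⟩⟩
  · exact ⟨fun a ha => ha.1, fun b hb c hc =>
      ⟨⟨rfl, show b.1 * c.2.1 = 0 by rw [hc.1, mul_zero]⟩,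
        ⟨rfl, show c.1 * b.2.1 = 0 by rw [show b.2.1 = 0 from hb, mul_zero]⟩⟩⟩

theorem not_isIdealOf_line : ¬ IsIdealOf (line F) ⊤ := by
  intro h
  have hmem := (h.2 ((0, 1, 0) : F × F × F) trivial ((1, 0, 0) : F × F × F) ⟨rfl, rfl⟩).2.2
  exact one_ne_zero ((mul_one (1 : F)).symm.trans hmem)

end StepTwo

end Counterexample

/-! ### Bounds for the subinvariant core -/

section Core

variable {F A : Type*} [Field F] [NonUnitalNonAssocRing A] [Module F A]
  [IsScalarTower F A A] [SMulCommClass F A A] {B : NonUnitalSubalgebra F A}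

theorem le_subinvariantCore {C : NonUnitalSubalgebra F A} (hC : IsSubinvariant C) (hCB : C ≤ B) :
    C ≤ subinvariantCore B :=
  fun _ hx => NonUnitalAlgebra.subset_adjoin F (Set.mem_biUnion (And.intro hC hCB) hx)

theorem subinvariantCore_le {M : NonUnitalSubalgebra F A}
    (h : ∀ C : NonUnitalSubalgebra F A, IsSubinvariant C → C ≤ B → C ≤ M) :
    subinvariantCore B ≤ M :=
  NonUnitalAlgebra.adjoin_le (Set.iUnion₂_subset fun C hC => h C hC.1 hC.2)

end Core

end Leibniz

theorem mainTheorem7 (F : Type u) [Field F] [CharZero F] :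
    (∀ (A : Type v) [NonUnitalNonAssocRing A] [Module F A] [IsScalarTower F A A]
        [SMulCommClass F A A] [FiniteDimensional F A] [IsLeftLeibniz A]
        (B : NonUnitalSubalgebra F A),
        Leibniz.IsIdealOf (Leibniz.subinvariantCore B) B ∧
        IsGreatest {C : NonUnitalSubalgebra F A | Leibniz.IsSubinvariant C ∧ C ≤ B}
          (Leibniz.subinvariantCore B) ∧
        ∀ C : NonUnitalSubalgebra F A,
          Maximal (fun D : NonUnitalSubalgebra F A => Leibniz.IsSubinvariant D ∧ D ≤ B) C ↔
            C = Leibniz.subinvariantCore B) ∧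
    ∃ (A : Type u) (_ : NonUnitalNonAssocRing A) (_ : Module F A) (_ : IsScalarTower F A A)
      (_ : SMulCommClass F A A) (_ : FiniteDimensional F A) (_ : IsLeftLeibniz A)
      (B : NonUnitalSubalgebra F A),
      ¬ Leibniz.IsIdealOf (Leibniz.subinvariantCore B) ⊤ := by
  refine ⟨?_, ?_⟩
  · intro A _ _ _ _ _ _ B
    obtain ⟨M, hM, hMB, hmax⟩ := Leibniz.exists_isSubinvariant_isIdealOf B
    have hcore : Leibniz.subinvariantCore B = M :=
      le_antisymm (Leibniz.subinvariantCore_le hmax) (Leibniz.le_subinvariantCore hM hMB.1)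
    have hgreatest :
        IsGreatest {C : NonUnitalSubalgebra F A | Leibniz.IsSubinvariant C ∧ C ≤ B} M :=
      ⟨⟨hM, hMB.1⟩, fun C hC => hmax C hC.1 hC.2⟩
    rw [hcore]
    exact ⟨hMB, hgreatest, fun C => hgreatest.maximal_iff⟩
  · refine ⟨Leibniz.StepTwo F, inferInstance, inferInstance, inferInstance, inferInstance,
      inferInstance, inferInstance, Leibniz.StepTwo.line F, fun h => ?_⟩
    have hcore : Leibniz.subinvariantCore (Leibniz.StepTwo.line F) = Leibniz.StepTwo.line F :=
      le_antisymm (Leibniz.subinvariantCore_le fun _ _ hC => hC)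
        (Leibniz.le_subinvariantCore (Leibniz.StepTwo.isSubinvariant_line F) le_rfl)
    rw [hcore] at h
    exact Leibniz.StepTwo.not_isIdealOf_line F h
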